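/- Let $n\ge 1$ and let $P\subset\mathbb{R}^n$ be an $n$-dimensional polytope, i.e. the convex hull of finitely many points, with nonempty interior. A frame is an orthonormal basis $F=\{u_1,\dots,u_n\}$ of $\mathbb{R}^n$. For a frame $F$ put $$\Psi(P;F)=\prod_{i=1}^n \operatorname{vol}_{n-1}(P\,|\,u_i^{\perp}),$$ where $P\,|\,u_i^{\perp}$ denotes the orthogonal projection of $P$ onto the hyperplane $u_i^\perp=\{x\in\mathbb{R}^n : \langle x,u_i\rangle=0\}$ and $\operatorname{vol}_{n-1}$ is the $(n-1)$-dimensional Lebesgue measure on that hyperplane. A frame $F$ is called a best frame for $P$ if $\Psi(P;F)\le\Psi(P;F')$ for every frame $F'$. Let $F=\{u_1,\dots,u_n\}$ be a best frame for $P$. Then for at least $n-1$ of the indices $i\in\{1,\dots,n\}$ there is a facet $G$ of $P$ (an $(n-1)$-dimensional face of $P$; it may depend on $i$) such that $u_i$ is parallel to $G$, i.e. $u_i$ lies in the linear subspace of directions of the affine hull of $G$. -/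

import Mathlib

open scoped ENNReal

noncomputable section

namespace LoomisWhitney

/-- A convex body in `ℝⁿ`: a compact convex set with nonempty interior. -/
structure IsConvexBody {n : ℕ} (K : Set (EuclideanSpace ℝ (Fin n))) : Prop where
  convex : Convex ℝ K
  isCompact : IsCompact K
  nonempty_interior : (interior K).Nonempty

/-- A polytope: the convex hull of finitely many points. -/
def IsPolytope {n : ℕ} (P : Set (EuclideanSpace ℝ (Fin n))) : Prop :=
  ∃ s : Set (EuclideanSpace ℝ (Fin n)), s.Finite ∧ P = convexHull ℝ s

/-- A facet of an `n`-dimensional polytope `P ⊆ ℝⁿ`: a nonempty exposed face (the set of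
maximizers over `P` of some linear functional) of affine dimension `n - 1`. -/
structure IsFacet {n : ℕ} (P F : Set (EuclideanSpace ℝ (Fin n))) : Prop where
  nonempty : F.Nonempty
  isExposed : IsExposed ℝ P F
  finrank_add_one : Module.finrank ℝ (affineSpan ℝ F).direction + 1 = n

/-- The vector `u` is parallel to the set `F`, that is, to its affine hull. -/
def ParallelTo {n : ℕ} (u : EuclideanSpace ℝ (Fin n))
    (F : Set (EuclideanSpace ℝ (Fin n))) : Prop :=
  u ∈ (affineSpan ℝ F).direction

/-- The `(n-1)`-dimensional volume of the orthogonal projection `K | u^⊥` of `K` onto the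
hyperplane `u^⊥` (for `u ≠ 0`). The measure is the Lebesgue measure of the Euclidean space `u^⊥`,
normalized to give volume one to the cubes spanned by orthonormal bases of `u^⊥`; the instance is
named explicitly, because the restriction of the Lebesgue measure of `ℝⁿ` to `u^⊥` would vanish. -/
def projVol {n : ℕ} (K : Set (EuclideanSpace ℝ (Fin n))) (u : EuclideanSpace ℝ (Fin n)) : ℝ≥0∞ :=
  (measureSpaceOfInnerProductSpace (E := (Submodule.span ℝ {u})ᗮ)).volume
    ((Submodule.span ℝ {u})ᗮ.orthogonalProjectionOnto '' K)

/-- The projection average of `K` for the frame (orthonormal basis) `u`. -/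
def projectionAverage {n : ℕ} (K : Set (EuclideanSpace ℝ (Fin n)))
    (u : OrthonormalBasis (Fin n) ℝ (EuclideanSpace ℝ (Fin n))) : ℝ≥0∞ :=
  ∏ i, projVol K (u i)

/-- A best frame for `K`: one that minimizes the projection average among all frames. -/
def IsBestFrame {n : ℕ} (K : Set (EuclideanSpace ℝ (Fin n)))
    (u : OrthonormalBasis (Fin n) ℝ (EuclideanSpace ℝ (Fin n))) : Prop :=
  ∀ v : OrthonormalBasis (Fin n) ℝ (EuclideanSpace ℝ (Fin n)),
    projectionAverage K u ≤ projectionAverage K v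

end LoomisWhitney

end

/-!
Suppose two members `uᵢ`, `uⱼ` of a best frame are both parallel to no facet of `P`. Rotate the pair
inside the plane it spans, leaving the other members of the frame alone. The key fact is that
`v ↦ vol (P | v^⊥)` agrees, for unit vectors `v` near a direction that is parallel to no facet, with
a linear functional (`exists_linear_eventually_projVol_eq`). Hence, near rotation angle `0`, the two
affected factors of the projection average are positive sinusoids `A cos (θ - α)` and
`B cos (θ - β)`. Each is strictly log-concave, so their product cannot have a local minimum at
`θ = 0`; with `t = tan θ` this is the polynomial statement `false_of_forall_small_mul_le`.

For the local linearity, a point of `P` is pushed along `v` until it reaches the part of the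
boundary visible from direction `v`. There it lies in an exposed face whose functional is
nonnegative on `v` (`exists_support_functional_along`). A polytope has finitely many exposed faces
(`finite_isExposed_convexHull`). Those of dimension at most `n - 2` have null projection, and the
others are the facets whose functional is positive on `v`; for `v` close to `u` they are the same
facets as for `u`. Cutting these facets into disjoint pieces `A`, the volume of `P | v^⊥` is the sum
of those of the projections of the pieces (`projVol_eq_sum_of_cover`).

Finally, if a piece `A` lies in a hyperplane `{l = c}`, then `vol (A | v^⊥)` is the `n`-dimensional
volume of the prism `A + (0, 1] v`, up to a shear along `v`; the prisms over `A` in two directions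
`u` and `v` differ by an affine map of determinant `l v / l u`. So the volume of `A | v^⊥` is
`l v / l u` times that of `A | u^⊥` (`projVol_eq_ofReal_mul_projVol`), which is linear in `v`.
-/

namespace LoomisWhitney

open MeasureTheory Module Set Filter Topology

/-! ### Shears and prisms -/

section Shear

variable {E : Type*} [NormedAddCommGroup E] [InnerProductSpace ℝ E] [FiniteDimensional ℝ E]
  [MeasurableSpace E] [BorelSpace E]

/-- The linear part of this map is a transvection, with determinant `1 + φ w`. -/
theorem volume_image_add_smul (φ : E →L[ℝ] ℝ) (c : ℝ) (w : E) (S : Set E) :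
    volume ((fun y ↦ y + (φ y + c) • w) '' S) = ENNReal.ofReal |1 + φ w| * volume S := by
  have h : (fun y ↦ y + (φ y + c) • w) '' S =
      (fun z ↦ c • w + z) '' (LinearMap.transvection (φ : E →ₗ[ℝ] ℝ) w '' S) := by
    rw [image_image]
    refine image_congr fun y _ ↦ ?_
    simp only [LinearMap.transvection.apply, ContinuousLinearMap.coe_coe, add_smul]
    abel
  rw [h, image_add_left, measure_preimage_add, Measure.addHaar_image_linearMap,
    LinearMap.transvection.det]
  rfl

/-- Fubini for the cylinder of height one over a base `B` in the hyperplane `v^⊥`. -/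
theorem volume_image_perp_prism (v : E) (hv : ‖v‖ = 1) (B : Set (ℝ ∙ v)ᗮ) :
    volume {y : E | (ℝ ∙ v)ᗮ.orthogonalProjectionOnto y ∈ B ∧ inner ℝ v y ∈ Ioc (0 : ℝ) 1} =
      (measureSpaceOfInnerProductSpace (E := (ℝ ∙ v)ᗮ)).volume B := by
  let e := LinearIsometryEquiv.toSpanUnitSingleton (𝕜 := ℝ) v hv
  have he : (measureSpaceOfInnerProductSpace (E := (ℝ ∙ v))).volume (e '' Ioc 0 1) = 1 := by
    rw [← e.coe_toMeasurableEquiv, MeasurableEquiv.image_eq_preimage_symm]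
    have := e.symm.measurePreserving.measure_preimage_equiv (f := e.toMeasurableEquiv.symm)
      (Ioc 0 1)
    erw [this]
    simp
  have h1 := ((ℝ ∙ v).orthogonalDecomposition.measurePreserving).measure_preimage_equiv
    (f := (ℝ ∙ v).orthogonalDecomposition.toMeasurableEquiv)
    (WithLp.ofLp ⁻¹' ((e '' Ioc 0 1) ×ˢ B))
  have h2 := (WithLp.volume_preserving_symm_measurableEquiv_toLp_prod
    (ℝ ∙ v) (ℝ ∙ v)ᗮ).measure_preimage_equiv ((e '' Ioc 0 1) ×ˢ B)
  erw [h2, Measure.volume_eq_prod, Measure.prod_prod, he, one_mul] at h1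
  rw [← h1]
  congr 1
  ext y
  have h3 : (ℝ ∙ v).orthogonalProjectionOnto y = e (inner ℝ v y) := by
    ext
    simp [e, Submodule.starProjection_unit_singleton ℝ hv]
  simp only [mem_ofPred_eq, mem_preimage, mem_prod, LinearIsometryEquiv.coe_toMeasurableEquiv,
    Submodule.orthogonalDecomposition_apply, h3, e.injective.mem_set_image]
  exact and_comm

end Shear

section Proj

variable {E : Type*} [NormedAddCommGroup E] [InnerProductSpace ℝ E]

theorem coe_orthogonalProjectionOnto_perp {v : E} (hv : ‖v‖ = 1) (y : E) :
    (((ℝ ∙ v)ᗮ.orthogonalProjectionOnto y : (ℝ ∙ v)ᗮ) : E) = y - inner ℝ v y • v := by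
  rw [Submodule.coe_orthogonalProjectionOnto_apply, Submodule.starProjection_orthogonal_val,
    Submodule.starProjection_unit_singleton ℝ hv]

theorem orthogonalProjectionOnto_perp_add_smul (v x : E) (t : ℝ) :
    (ℝ ∙ v)ᗮ.orthogonalProjectionOnto (x + t • v) = (ℝ ∙ v)ᗮ.orthogonalProjectionOnto x := by
  rw [map_add, map_smul, Submodule.orthogonalProjectionOnto_orthogonal_apply_eq_zero
    (Submodule.mem_span_singleton_self v)]
  simp

theorem exists_eq_add_smul_of_orthogonalProjectionOnto_eq {v : E} (hv : ‖v‖ = 1) {x y : E}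
    (h : (ℝ ∙ v)ᗮ.orthogonalProjectionOnto x = (ℝ ∙ v)ᗮ.orthogonalProjectionOnto y) :
    ∃ t : ℝ, y = x + t • v := by
  have h' := congrArg (Subtype.val) h
  rw [coe_orthogonalProjectionOnto_perp hv, coe_orthogonalProjectionOnto_perp hv] at h'
  refine ⟨inner ℝ v y - inner ℝ v x, ?_⟩
  rw [sub_smul, ← sub_eq_zero]
  rw [← sub_eq_zero] at h'
  rw [← neg_eq_zero, ← h']
  abel

end Proj

variable {n : ℕ}

local notation "𝔼" => EuclideanSpace ℝ (Fin n)

/-! ### Volumes of projections -/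

theorem projVol_eq_volume_prism {v : 𝔼} (hv : ‖v‖ = 1) (A : Set 𝔼) :
    projVol A v = volume {y : 𝔼 | (ℝ ∙ v)ᗮ.orthogonalProjectionOnto y ∈
      (ℝ ∙ v)ᗮ.orthogonalProjectionOnto '' A ∧ inner ℝ v y ∈ Ioc (0 : ℝ) 1} :=
  (volume_image_perp_prism v hv _).symm

/-- The volume of the projection of a flat piece `A` along `v` is the volume of the oblique prism
`A + (0, 1] v`: a shear along `v` takes this prism to the right prism over the projection of `A`. -/
theorem projVol_eq_volume_image2 {v : 𝔼} (hv : ‖v‖ = 1) {A : Set 𝔼} {l : StrongDual ℝ 𝔼} {c : ℝ}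
    (hA : ∀ x ∈ A, l x = c) (hl : 0 < l v) :
    projVol A v = volume (image2 (fun x t ↦ x + t • v) A (Ioc (0 : ℝ) 1)) := by
  have hvv : inner ℝ v v = (1 : ℝ) := by rw [real_inner_self_eq_norm_sq, hv, one_pow]
  have key := volume_image_add_smul ((l v)⁻¹ • l - innerSL ℝ v) (-(c / l v)) v
    (image2 (fun x t ↦ x + t • v) A (Ioc (0 : ℝ) 1))
  have h1 : 1 + ((l v)⁻¹ • l - innerSL ℝ v) v = 1 := by
    simp [hvv, hl.ne', -inner_self_eq_norm_sq_to_K]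
  rw [h1, abs_one, ENNReal.ofReal_one, one_mul] at key
  rw [← key, projVol_eq_volume_prism hv]
  congr 1
  -- the shear keeps lines along `v` and moves `x ∈ A` to its projection onto `v^⊥`
  have hmap : ∀ x ∈ A, ∀ t : ℝ, (x + t • v) + (((l v)⁻¹ • l - innerSL ℝ v) (x + t • v) +
      -(c / l v)) • v = x + (t - inner ℝ v x) • v := by
    intro x hx t
    have : ((l v)⁻¹ • l - innerSL ℝ v) (x + t • v) + -(c / l v) = - inner ℝ v x := by
      simp only [map_add, map_smul, sub_apply, smul_apply,
        innerSL_apply_apply, hvv, hA x hx, smul_eq_mul]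
      field_simp
      ring
    rw [this]
    module
  ext y
  constructor
  · rintro ⟨⟨x, hx, hxy⟩, ht⟩
    obtain ⟨s, rfl⟩ := exists_eq_add_smul_of_orthogonalProjectionOnto_eq hv hxy
    refine ⟨_, ⟨x, hx, _, ht, rfl⟩, ?_⟩
    dsimp only
    rw [hmap x hx]
    congr 2
    rw [inner_add_right, inner_smul_right, hvv]
    ring
  · rintro ⟨_, ⟨x, hx, t, ht, rfl⟩, rfl⟩
    dsimp only
    rw [hmap x hx]
    refine ⟨⟨x, hx, (orthogonalProjectionOnto_perp_add_smul _ _ _).symm⟩, ?_⟩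
    rw [inner_add_right, inner_smul_right, hvv]
    convert ht using 1
    ring

/-- The volume of the projection of a flat piece along `v` is linear in `v`: the affine map that
fixes the hyperplane `{l = c}` pointwise and whose linear part takes `u` to `v` carries the prism
over `A` along `u` to the one along `v`. -/
theorem projVol_eq_ofReal_mul_projVol {u v : 𝔼} (hu : ‖u‖ = 1) (hv : ‖v‖ = 1) {A : Set 𝔼}
    {l : StrongDual ℝ 𝔼} {c : ℝ} (hA : ∀ x ∈ A, l x = c) (hlu : 0 < l u) (hlv : 0 < l v) :
    projVol A v = ENNReal.ofReal (l v / l u) * projVol A u := by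
  rw [projVol_eq_volume_image2 hv hA hlv, projVol_eq_volume_image2 hu hA hlu]
  have key := volume_image_add_smul ((l u)⁻¹ • l) (-(c / l u)) (v - u)
    (image2 (fun x t ↦ x + t • u) A (Ioc (0 : ℝ) 1))
  have h1 : |1 + ((l u)⁻¹ • l) (v - u)| = l v / l u := by
    rw [abs_of_pos]
    all_goals simp only [map_sub, smul_apply, smul_eq_mul]
    · field_simp
      ring
    · have : 1 + ((l u)⁻¹ * l v - (l u)⁻¹ * l u) = l v / l u := by field_simp; ring
      rw [this]; positivity
  rw [← h1, ← key, image_image2]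
  congr 1
  refine image2_congr fun x hx t _ ↦ ?_
  have : ((l u)⁻¹ • l) (x + t • u) + -(c / l u) = t := by
    simp only [map_add, map_smul, smul_apply, hA x hx, smul_eq_mul]
    field_simp
    ring
  rw [this]
  module

/-- Sets of codimension at least two have null projections: the prism over the projection lies in
the proper affine subspace spanned by the set and the direction of projection. -/
theorem projVol_eq_zero_of_finrank_direction {v : 𝔼} (hv : ‖v‖ = 1) {A : Set 𝔼}
    (hA : finrank ℝ (affineSpan ℝ A).direction + 1 < n) : projVol A v = 0 := by
  rcases A.eq_empty_or_nonempty with rfl | ⟨a, ha⟩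
  · simp [projVol]
  rw [projVol_eq_volume_prism hv]
  set D := (affineSpan ℝ A).direction ⊔ (ℝ ∙ v) with hD
  have hDtop : D ≠ ⊤ := by
    intro h
    have h1 := Submodule.finrank_add_le_finrank_add_finrank (affineSpan ℝ A).direction (ℝ ∙ v)
    have h2 := finrank_span_le_card (R := ℝ) ({v} : Set 𝔼)
    rw [← hD, h, finrank_top, finrank_euclideanSpace_fin] at h1
    simp only [toFinset_singleton, Finset.card_singleton] at h2
    omega
  refine measure_mono_null ?_ (Measure.addHaar_affineSubspace volume (AffineSubspace.mk' a D) ?_)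
  · rintro y ⟨⟨x, hx, hxy⟩, -⟩
    obtain ⟨s, rfl⟩ := exists_eq_add_smul_of_orthogonalProjectionOnto_eq hv hxy
    rw [SetLike.mem_coe, AffineSubspace.mem_mk', vsub_eq_sub, add_sub_right_comm]
    refine add_mem (Submodule.mem_sup_left ?_) (Submodule.mem_sup_right
      (Submodule.smul_mem _ _ (Submodule.mem_span_singleton_self v)))
    exact AffineSubspace.vsub_mem_direction (subset_affineSpan ℝ A hx) (subset_affineSpan ℝ A ha)
  · intro h
    apply hDtop
    rw [← AffineSubspace.direction_mk' a D, h, AffineSubspace.direction_top]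

theorem projVol_lt_top (K : Set 𝔼) (hK : IsCompact K) (v : 𝔼) : projVol K v < ⊤ :=
  (hK.image (ContinuousLinearMap.continuous _)).measure_lt_top

theorem projVol_pos {K : Set 𝔼} (hK : (interior K).Nonempty) (v : 𝔼) : 0 < projVol K v := by
  refine lt_of_lt_of_le ?_ (measure_mono (image_mono interior_subset))
  refine IsOpen.measure_pos _ ?_ (hK.image _)
  refine ContinuousLinearMap.isOpenMap _ ?_ _ isOpen_interior
  intro y
  exact ⟨y, Submodule.orthogonalProjectionOnto_mem_subspace_eq_self y⟩

/-! ### Exposed faces and facets of polytopes -/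

section Faces

variable {V : Type*} [NormedAddCommGroup V] [NormedSpace ℝ V]

/-- By Krein–Milman an exposed face of the convex hull of `s` is the convex hull of the points of
`s` that it contains, so it is determined by a subset of `s`. -/
theorem finite_isExposed_convexHull {s : Set V} (hs : s.Finite) :
    {F : Set V | IsExposed ℝ (convexHull ℝ s) F}.Finite := by
  have hmaps : MapsTo (fun F ↦ s ∩ F) {F : Set V | IsExposed ℝ (convexHull ℝ s) F} (𝒫 s) :=
    fun F _ ↦ inter_subset_left
  refine hs.finite_subsets.of_injOn hmaps (Set.LeftInvOn.injOn (f₁' := convexHull ℝ) ?_)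
  intro F hF
  have hconv : Convex ℝ F := hF.convex (convex_convexHull ℝ s)
  refine subset_antisymm (convexHull_min inter_subset_right hconv) ?_
  have hcomp : IsCompact F := hF.isCompact (hs.isCompact_convexHull ℝ)
  have hext : F.extremePoints ℝ ⊆ s ∩ F := fun x hx ↦
    ⟨extremePoints_convexHull_subset (hF.isExtreme.extremePoints_subset_extremePoints hx), hx.1⟩
  calc F = closure (convexHull ℝ (F.extremePoints ℝ)) :=
        (closure_convexHull_extremePoints hcomp hconv).symm
    _ ⊆ closure (convexHull ℝ (s ∩ F)) := closure_mono (convexHull_mono hext)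
    _ = convexHull ℝ (s ∩ F) :=
        ((hs.subset inter_subset_left).isCompact_convexHull ℝ).isClosed.closure_eq

theorem direction_affineSpan_le_ker {F : Set V} {l : StrongDual ℝ V}
    (h : ∀ x ∈ F, ∀ y ∈ F, l x = l y) :
    (affineSpan ℝ F).direction ≤ LinearMap.ker (l : V →ₗ[ℝ] ℝ) := by
  rw [direction_affineSpan, vectorSpan_def, Submodule.span_le]
  rintro _ ⟨x, hx, y, hy, rfl⟩
  simp [h x hx y hy]

/-- Every point of `P` can be moved along `v` to a point of the boundary of `P` that is visible
from infinity in direction `v`; the supporting functional there comes from separating the interior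
of `P` from the ray that leaves `P`. -/
theorem exists_support_functional_along {P : Set V} (hconv : Convex ℝ P) (hcomp : IsCompact P)
    (hint : (interior P).Nonempty) {v : V} (hv : v ≠ 0) {y : V} (hy : y ∈ P) :
    ∃ t : ℝ, y + t • v ∈ P ∧ ∃ l : StrongDual ℝ V, l ≠ 0 ∧ 0 ≤ l v ∧
      ∀ z ∈ P, l z ≤ l (y + t • v) := by
  have hemb : Topology.IsClosedEmbedding (fun t : ℝ ↦ y + t • v) :=
    (Homeomorph.addLeft y).isClosedEmbedding.comp (isClosedEmbedding_smul_left hv)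
  obtain ⟨t, ht, hmax⟩ := (hemb.isCompact_preimage hcomp).exists_isGreatest ⟨0, by simpa using hy⟩
  refine ⟨t, ht, ?_⟩
  set x := y + t • v with hx
  have hray : ∀ r : ℝ, 0 < r → x + r • v ∉ P := by
    intro r hr hmem
    have : t + r ≤ t := hmax (by simpa [hx, add_smul, add_assoc] using hmem)
    linarith
  have hrayconv : Convex ℝ ((fun r : ℝ ↦ x + r • v) '' Ioi 0) := by
    rw [← image_image (fun z ↦ x + z) (fun r : ℝ ↦ r • v)]
    exact ((convex_Ioi 0).is_linear_image (IsLinearMap.isLinearMap_smul' v)).translate x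
  have hdisj : Disjoint (interior P) ((fun r : ℝ ↦ x + r • v) '' Ioi 0) := by
    rw [disjoint_left]
    rintro _ h ⟨r, hr, rfl⟩
    exact hray r hr (interior_subset h)
  obtain ⟨l, c, hlt, hge⟩ :=
    geometric_hahn_banach_open hconv.interior isOpen_interior hrayconv hdisj
  have hle : ∀ z ∈ P, l z ≤ c := by
    intro z hz
    have hz' : z ∈ closure (interior P) := by
      rw [hconv.closure_interior_eq_closure_of_nonempty_interior hint]
      exact subset_closure hz
    exact closure_minimal (fun w hw ↦ (hlt w hw).le)
      (isClosed_le l.continuous continuous_const) hz'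
  have hge' : ∀ r : ℝ, 0 < r → c ≤ l x + r * l v := by
    intro r hr
    simpa using hge _ ⟨r, hr, rfl⟩
  have hlx : c ≤ l x := by
    have hcont : Continuous fun r : ℝ ↦ l x + r * l v := by fun_prop
    have := ge_of_tendsto (hcont.continuousWithinAt (s := Ioi 0) (x := 0)).tendsto
      (Filter.eventually_of_mem self_mem_nhdsWithin hge')
    simpa using this
  refine ⟨l, ?_, ?_, fun z hz ↦ (hle z hz).trans hlx⟩
  · rintro rfl
    obtain ⟨p, hp⟩ := hint
    have h1 := hlt p hp
    simp only [zero_apply] at h1 hlx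
    linarith
  · have := hge' 1 one_pos
    have := hle x ht
    linarith

end Faces

theorem finrank_ker_add_one {l : StrongDual ℝ 𝔼} (hl : l ≠ 0) :
    finrank ℝ (LinearMap.ker (l : 𝔼 →ₗ[ℝ] ℝ)) + 1 = n := by
  rw [Module.Dual.finrank_ker_add_one_of_ne_zero (f := (l : 𝔼 →ₗ[ℝ] ℝ))
    (fun h ↦ hl (ContinuousLinearMap.coe_injective h)), finrank_euclideanSpace_fin]

theorem IsFacet.ne_self {P F : Set 𝔼} (hF : IsFacet P F) (hint : (interior P).Nonempty) :
    F ≠ P := by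
  rintro rfl
  have := hF.finrank_add_one
  rw [affineSpan_eq_top_of_nonempty_interior (hint.mono (interior_mono (subset_convexHull ℝ _))),
    AffineSubspace.direction_top, finrank_top, finrank_euclideanSpace_fin] at this
  omega

theorem IsFacet.direction_eq_ker {P F : Set 𝔼} (hF : IsFacet P F)
    (hint : (interior P).Nonempty) {l : StrongDual ℝ 𝔼}
    (hl : F = {x ∈ P | ∀ y ∈ P, l y ≤ l x}) :
    (affineSpan ℝ F).direction = LinearMap.ker (l : 𝔼 →ₗ[ℝ] ℝ) := by
  -- the zero functional exposes all of `P`, which has full dimension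
  have hl0 : l ≠ 0 := by
    rintro rfl
    exact hF.ne_self hint (by simpa using hl)
  refine Submodule.eq_of_le_of_finrank_eq (direction_affineSpan_le_ker ?_) ?_
  · intro x hx y hy
    rw [hl] at hx hy
    exact le_antisymm (hy.2 x hx.1) (hx.2 y hy.1)
  · have := hF.finrank_add_one
    have := finrank_ker_add_one hl0
    omega

theorem IsFacet.parallelTo_iff {P F : Set 𝔼} (hF : IsFacet P F)
    (hint : (interior P).Nonempty) {l : StrongDual ℝ 𝔼}
    (hl : F = {x ∈ P | ∀ y ∈ P, l y ≤ l x}) {u : 𝔼} : ParallelTo u F ↔ l u = 0 := by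
  rw [ParallelTo, hF.direction_eq_ker hint hl, LinearMap.mem_ker, ContinuousLinearMap.coe_coe]

/-- The functional exposing a facet is unique up to a positive factor. -/
theorem IsFacet.exists_pos_smul_eq {P F : Set 𝔼} (hF : IsFacet P F)
    (hint : (interior P).Nonempty) {l l' : StrongDual ℝ 𝔼}
    (hl : F = {x ∈ P | ∀ y ∈ P, l y ≤ l x}) (hl' : F = {x ∈ P | ∀ y ∈ P, l' y ≤ l' x}) :
    ∃ c : ℝ, 0 < c ∧ l' = c • l := by
  obtain ⟨q, hq⟩ := hF.nonempty
  have hsub : F ⊆ P := hF.isExposed.subset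
  obtain ⟨p, hpP, hpF⟩ : ∃ p ∈ P, p ∉ F := by
    by_contra! h
    exact hF.ne_self hint (subset_antisymm hsub h)
  have aux : ∀ m : StrongDual ℝ 𝔼, F = {x ∈ P | ∀ y ∈ P, m y ≤ m x} → 0 < m (q - p) := by
    intro m hm
    have hp : ¬ ∀ y ∈ P, m y ≤ m p := fun h ↦ hpF (by rw [hm]; exact ⟨hpP, h⟩)
    push Not at hp
    obtain ⟨y, hy, hlt⟩ := hp
    rw [hm] at hq
    have := hq.2 y hy
    rw [map_sub]
    linarith
  have h1 := aux l hl
  have h2 := aux l' hl'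
  refine ⟨l' (q - p) / l (q - p), div_pos h2 h1, ?_⟩
  ext x
  have hker : x - (l x / l (q - p)) • (q - p) ∈ LinearMap.ker (l : 𝔼 →ₗ[ℝ] ℝ) := by
    rw [LinearMap.mem_ker, ContinuousLinearMap.coe_coe, map_sub, map_smul, smul_eq_mul,
      div_mul_cancel₀ _ h1.ne', sub_self]
  rw [← hF.direction_eq_ker hint hl, hF.direction_eq_ker hint hl', LinearMap.mem_ker,
    ContinuousLinearMap.coe_coe, map_sub, map_smul, smul_eq_mul, sub_eq_zero] at hker
  rw [hker, smul_apply, smul_eq_mul]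
  ring

/-! ### Local linearity of the projection volume -/

/-- The sets `G j` are the faces visible from direction `v`, and `N` collects the faces that the
projection makes negligible. A visible point is determined by its projection, so disjoint pieces of
visible faces have disjoint projections. -/
theorem projVol_eq_sum_of_cover {P : Set 𝔼} (hP : IsCompact P) {v : 𝔼} (hv : ‖v‖ = 1) {k : ℕ}
    {G : Fin k → Set 𝔼} {l : Fin k → StrongDual ℝ 𝔼}
    (hG : ∀ j, G j = {x ∈ P | ∀ y ∈ P, l j y ≤ l j x}) (hl : ∀ j, 0 < l j v)
    {N : Set (Set 𝔼)} (hN : N.Finite) (hN0 : ∀ F ∈ N, projVol F v = 0)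
    (hcover : ∀ y ∈ P, ∃ t : ℝ, y + t • v ∈ (⋃ j, G j) ∪ ⋃₀ N) :
    projVol P v = ∑ j, projVol (disjointed G j) v := by
  have hGmeas : ∀ j, MeasurableSet (G j) := fun j ↦ by
    have hexp : IsExposed ℝ P (G j) := fun _ ↦ ⟨l j, hG j⟩
    exact (hexp.isCompact hP).isClosed.measurableSet
  have hmem : ∀ j, ∀ x ∈ G j, x ∈ P ∧ ∀ y ∈ P, l j y ≤ l j x := fun j x hx ↦ by
    rwa [hG j] at hx
  -- a line parallel to `v` meets the union of the `G j` in at most one point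
  have hinj : InjOn (ℝ ∙ v)ᗮ.orthogonalProjectionOnto (⋃ j, G j) := by
    intro x hx y hy hxy
    obtain ⟨i, hxi⟩ := mem_iUnion.1 hx
    obtain ⟨j, hyj⟩ := mem_iUnion.1 hy
    obtain ⟨t, rfl⟩ := exists_eq_add_smul_of_orthogonalProjectionOnto_eq hv hxy
    have h1 := (hmem i x hxi).2 _ (hmem j _ hyj).1
    have h2 := (hmem j _ hyj).2 _ (hmem i x hxi).1
    rw [map_add, map_smul, smul_eq_mul] at h1 h2
    have ht : t = 0 := le_antisymm (by nlinarith [hl i]) (by nlinarith [hl j])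
    simp [ht]
  have hsub : ∀ j, disjointed G j ⊆ ⋃ j, G j := fun j ↦
    (disjointed_subset G j).trans (subset_iUnion G j)
  let μ := (measureSpaceOfInnerProductSpace (E := (ℝ ∙ v)ᗮ)).volume
  have hsum : ∑ j, projVol (disjointed G j) v =
      μ ((ℝ ∙ v)ᗮ.orthogonalProjectionOnto '' ⋃ j, G j) := by
    rw [← iUnion_disjointed, image_iUnion, measure_iUnion, tsum_fintype]
    · rfl
    · intro i j hij
      exact (disjoint_disjointed G hij).image hinj (hsub i) (hsub j)
    · intro j
      have hmeas : MeasurableSet (disjointed G j) :=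
        disjointedRec (p := MeasurableSet) (fun _ i h ↦ h.diff (hGmeas i)) (hGmeas j)
      exact hmeas.image_of_continuousOn_injOn
        (ContinuousLinearMap.continuous _).continuousOn (hinj.mono (hsub j))
  rw [hsum]
  apply le_antisymm
  · have hnull : μ ((ℝ ∙ v)ᗮ.orthogonalProjectionOnto '' ⋃₀ N) = 0 := by
      rw [sUnion_eq_biUnion, image_iUnion₂]
      exact (measure_biUnion_null_iff hN.countable).2 hN0
    rw [← add_zero (μ _), ← hnull]
    refine le_trans (measure_mono ?_) (measure_union_le _ _)
    rintro _ ⟨y, hy, rfl⟩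
    obtain ⟨t, ht⟩ := hcover y hy
    rw [← image_union, ← orthogonalProjectionOnto_perp_add_smul v y t]
    exact mem_image_of_mem _ ht
  · exact measure_mono (image_mono (iUnion_subset fun j x hx ↦ (hmem j x hx).1))

/-- Near a direction parallel to no facet of a polytope, the volume of the projection is the
restriction of a linear functional to the unit sphere. -/
theorem exists_linear_eventually_projVol_eq {P : Set 𝔼} (hP : IsConvexBody P)
    (hPoly : IsPolytope P) {u : 𝔼} (hu : ‖u‖ = 1)
    (hpar : ∀ F, IsFacet P F → ¬ ParallelTo u F) :
    ∃ a : StrongDual ℝ 𝔼, ∀ᶠ v in 𝓝 u, ‖v‖ = 1 → projVol P v = ENNReal.ofReal (a v) := by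
  have hint := hP.nonempty_interior
  have hfin : {F : Set 𝔼 | IsExposed ℝ P F}.Finite := by
    obtain ⟨s, hs, rfl⟩ := hPoly
    exact finite_isExposed_convexHull hs
  have hfacets : {F : Set 𝔼 | IsFacet P F}.Finite := hfin.subset fun F hF ↦ hF.isExposed
  have hexists : ∀ F : Set 𝔼, ∃ l : StrongDual ℝ 𝔼, IsFacet P F →
      F = {x ∈ P | ∀ y ∈ P, l y ≤ l x} := by
    intro F
    by_cases hF : IsFacet P F
    · obtain ⟨l, hl⟩ := hF.isExposed hF.nonempty
      exact ⟨l, fun _ ↦ hl⟩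
    · exact ⟨0, fun h ↦ absurd h hF⟩
  choose m hm using hexists
  -- `G` enumerates the facets visible from direction `u`
  obtain ⟨k, G, -, hG⟩ := (hfacets.subset
    (sep_subset {F : Set 𝔼 | IsFacet P F} (fun F ↦ 0 < m F u))).fin_param
  have hGmem : ∀ j, IsFacet P (G j) ∧ 0 < m (G j) u := fun j ↦ by
    have : G j ∈ range G := mem_range_self j
    rwa [hG] at this
  -- near `u`, no facet functional changes sign
  have hev : ∀ᶠ v in 𝓝 u, ∀ F ∈ {F : Set 𝔼 | IsFacet P F}, 0 < m F v * m F u := by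
    rw [eventually_all_finite hfacets]
    intro F hF
    have h0 : m F u ≠ 0 := fun h ↦ hpar F hF ((hF.parallelTo_iff hint (hm F hF)).2 h)
    have hcont : Continuous fun v ↦ m F v * m F u := by fun_prop
    exact hcont.continuousAt.eventually_const_lt (mul_self_pos.2 h0)
  let N : Set (Set 𝔼) := {F | IsExposed ℝ P F ∧ finrank ℝ (affineSpan ℝ F).direction + 1 < n}
  have hN : N.Finite := hfin.subset fun F hF ↦ hF.1
  -- the facets with functional positive on `u` are the ones visible from any nearby `v`
  have hsum : ∀ v : 𝔼, (∀ F ∈ {F : Set 𝔼 | IsFacet P F}, 0 < m F v * m F u) → ‖v‖ = 1 →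
      projVol P v = ∑ j, projVol (disjointed G j) v := by
    intro v hsign hv
    refine projVol_eq_sum_of_cover hP.isCompact hv (l := fun j ↦ m (G j))
      (fun j ↦ hm _ (hGmem j).1) (fun j ↦ pos_of_mul_pos_left (hsign _ (hGmem j).1) (hGmem j).2.le)
      hN (fun F hF ↦ projVol_eq_zero_of_finrank_direction hv hF.2) ?_
    intro y hy
    obtain ⟨t, ht, l, hl0, hlv, hmax⟩ := exists_support_functional_along hP.convex hP.isCompact
      hint (norm_ne_zero_iff.1 (hv ▸ one_ne_zero)) hy
    refine ⟨t, ?_⟩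
    set x := y + t • v
    set F : Set 𝔼 := {x ∈ P | ∀ y ∈ P, l y ≤ l x} with hF
    have hxF : x ∈ F := ⟨ht, hmax⟩
    have hexp : IsExposed ℝ P F := fun _ ↦ ⟨l, rfl⟩
    have hdim : finrank ℝ (affineSpan ℝ F).direction + 1 ≤ n := by
      have h1 := Submodule.finrank_mono (direction_affineSpan_le_ker (F := F) (l := l)
        fun x hx y hy ↦ le_antisymm (hy.2 x hx.1) (hx.2 y hy.1))
      have h2 := finrank_ker_add_one hl0
      omega
    rcases hdim.lt_or_eq with hlt | heq
    · exact Or.inr ⟨F, ⟨hexp, hlt⟩, hxF⟩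
    · have hfacet : IsFacet P F := ⟨⟨x, hxF⟩, hexp, heq⟩
      obtain ⟨c, hc, hlc⟩ := hfacet.exists_pos_smul_eq hint (hm F hfacet) hF
      have hmv : 0 ≤ m F v := by
        rw [hlc, smul_apply, smul_eq_mul] at hlv
        exact nonneg_of_mul_nonneg_right hlv hc
      have hmu : 0 < m F u := pos_of_mul_pos_right (hsign F hfacet) hmv
      have hFG : F ∈ range G := by rw [hG]; exact ⟨hfacet, hmu⟩
      obtain ⟨j, hj⟩ := hFG
      exact Or.inl (mem_iUnion.2 ⟨j, hj ▸ hxF⟩)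
  refine ⟨∑ j, ((projVol (disjointed G j) u).toReal / m (G j) u) • m (G j), ?_⟩
  filter_upwards [hev] with v hsign hv
  have hposv : ∀ j, 0 < m (G j) v := fun j ↦
    pos_of_mul_pos_left (hsign _ (hGmem j).1) (hGmem j).2.le
  rw [hsum v hsign hv, sum_apply, ENNReal.ofReal_sum_of_nonneg]
  · refine Finset.sum_congr rfl fun j _ ↦ ?_
    have hsub : disjointed G j ⊆ P :=
      (disjointed_subset G j).trans (hGmem j).1.isExposed.subset
    have hlt : projVol (disjointed G j) u < ⊤ :=
      (measure_mono (image_mono hsub)).trans_lt (projVol_lt_top P hP.isCompact u)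
    obtain ⟨x₀, hx₀⟩ := (hGmem j).1.nonempty
    rw [projVol_eq_ofReal_mul_projVol hu hv (l := m (G j)) (c := m (G j) x₀) ?_ (hGmem j).2
      (hposv j)]
    · nth_rewrite 1 [← ENNReal.ofReal_toReal hlt.ne]
      rw [← ENNReal.ofReal_mul (div_nonneg (hposv j).le (hGmem j).2.le), smul_apply, smul_eq_mul]
      congr 1
      ring
    · intro x hx
      have hx' := disjointed_subset G j hx
      rw [hm _ (hGmem j).1] at hx' hx₀
      exact le_antisymm (hx₀.2 x hx'.1) (hx'.2 x₀ hx₀.1)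
  · intro j _
    exact mul_nonneg (div_nonneg ENNReal.toReal_nonneg (hGmem j).2.le) (hposv j).le

/-! ### Rotating two members of a frame -/

/-- With `t = tan θ`, this says that the product of `a₁ cos θ + a₂ sin θ` and `b₂ cos θ - b₁ sin θ`,
both positive at `θ = 0`, has no local minimum there. -/
theorem false_of_forall_small_mul_le {a₁ a₂ b₁ b₂ : ℝ} (ha : 0 < a₁) (hb : 0 < b₂)
    (h : ∀ᶠ t : ℝ in 𝓝 0, a₁ * b₂ * (1 + t ^ 2) ≤ (a₁ + t * a₂) * (b₂ - t * b₁)) : False := by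
  obtain ⟨ε, hε, h⟩ := Metric.eventually_nhds_iff.1 h
  have key : ∀ t : ℝ, |t| < ε → t ^ 2 * (a₁ * b₂ + a₂ * b₁) ≤ t * (a₂ * b₂ - a₁ * b₁) := by
    intro t ht
    have := h (y := t) (by simpa using ht)
    nlinarith
  set d := a₂ * b₂ - a₁ * b₁ with hd
  set e := a₁ * b₂ + a₂ * b₁ with he
  -- adding the inequalities for `t` and `-t` bounds the second-order term
  have he0 : e ≤ 0 := by
    have h1 := key (ε / 2) (by rw [abs_of_pos (by positivity)]; linarith)
    have h2 := key (-(ε / 2)) (by rw [abs_neg, abs_of_pos (by positivity)]; linarith)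
    have : 0 < (ε / 2) ^ 2 := by positivity
    nlinarith
  -- the first-order term vanishes, as otherwise it dominates for small `t`
  have hd0 : d = 0 := by
    have hlim : Tendsto (fun t : ℝ ↦ t * e) (𝓝 0) (𝓝 0) := by
      simpa using (continuous_id.mul continuous_const).tendsto (0 : ℝ) (f := fun t : ℝ ↦ t * e)
    have hball : ∀ᶠ t : ℝ in 𝓝 0, |t| < ε := by
      filter_upwards [Metric.ball_mem_nhds (0 : ℝ) hε] with t ht
      simpa using ht
    apply le_antisymm
    · refine le_of_tendsto_of_tendsto (tendsto_const_nhds (f := 𝓝[<] (0 : ℝ)))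
        (hlim.mono_left nhdsWithin_le_nhds) ?_
      filter_upwards [self_mem_nhdsWithin, nhdsWithin_le_nhds hball] with t ht htε
      have := key t htε
      have ht' : t < 0 := ht
      nlinarith
    · refine le_of_tendsto_of_tendsto (hlim.mono_left nhdsWithin_le_nhds)
        (tendsto_const_nhds (f := 𝓝[>] (0 : ℝ))) ?_
      filter_upwards [self_mem_nhdsWithin, nhdsWithin_le_nhds hball] with t ht htε
      have := key t htε
      have ht' : 0 < t := ht
      nlinarith
  -- hence `a₂ * b₁` is nonnegative, so that `e` is positive
  have h1 : a₂ * b₁ * b₂ = a₁ * b₁ ^ 2 := by linear_combination b₁ * hd0 - b₁ * hd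
  have h2 : 0 ≤ a₁ * b₁ ^ 2 := by positivity
  have h3 : 0 < a₁ * b₂ * b₂ := by positivity
  nlinarith

/-- The rotation by the angle `arctan t` in the plane of two members of an orthonormal basis. -/
theorem exists_orthonormalBasis_rotate (u : OrthonormalBasis (Fin n) ℝ 𝔼) {i j : Fin n}
    (hij : i ≠ j) (t : ℝ) :
    ∃ w : OrthonormalBasis (Fin n) ℝ 𝔼, w i = (√(1 + t ^ 2))⁻¹ • (u i + t • u j) ∧
      w j = (√(1 + t ^ 2))⁻¹ • (u j - t • u i) ∧ ∀ k, k ≠ i → k ≠ j → w k = u k := by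
  set r := (√(1 + t ^ 2))⁻¹ with hr
  have hr2 : r * r * (1 + t ^ 2) = 1 := by
    rw [hr, ← mul_inv, Real.mul_self_sqrt (by positivity)]
    exact inv_mul_cancel₀ (by positivity)
  have hself : ∀ k : Fin n, inner ℝ (u k) (u k) = (1 : ℝ) := fun k ↦ by
    rw [real_inner_self_eq_norm_sq, u.norm_eq_one, one_pow]
  have horth : ∀ k m : Fin n, k ≠ m → inner ℝ (u k) (u m) = (0 : ℝ) := fun k m h ↦
    u.orthonormal.2 h
  set p := r • (u i + t • u j) with hp
  set q := r • (u j - t • u i) with hq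
  have hpp : inner ℝ p p = (1 : ℝ) := by
    simp only [hp, inner_add_left, inner_add_right, real_inner_smul_left, real_inner_smul_right,
      hself, horth i j hij, horth j i hij.symm]
    linear_combination hr2
  have hqq : inner ℝ q q = (1 : ℝ) := by
    simp only [hq, inner_sub_left, inner_sub_right, real_inner_smul_left, real_inner_smul_right,
      hself, horth i j hij, horth j i hij.symm]
    linear_combination hr2
  have hpq : inner ℝ p q = (0 : ℝ) := by
    simp only [hp, hq, inner_add_left, inner_sub_right, real_inner_smul_left,
      real_inner_smul_right, hself, horth i j hij, horth j i hij.symm]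
    ring
  have hpk : ∀ k, k ≠ i → k ≠ j → inner ℝ p (u k) = (0 : ℝ) := fun k hki hkj ↦ by
    simp only [hp, inner_add_left, real_inner_smul_left, horth i k hki.symm, horth j k hkj.symm]
    ring
  have hqk : ∀ k, k ≠ i → k ≠ j → inner ℝ q (u k) = (0 : ℝ) := fun k hki hkj ↦ by
    simp only [hq, inner_sub_left, real_inner_smul_left, horth i k hki.symm, horth j k hkj.symm]
    ring
  set f : Fin n → 𝔼 := fun k ↦ if k = i then p else if k = j then q else u k with hf
  have hon : Orthonormal ℝ f := by
    refine ⟨fun k ↦ ?_, fun k m hkm ↦ ?_⟩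
    · rw [← pow_eq_one_iff_of_nonneg (norm_nonneg _) two_ne_zero, ← real_inner_self_eq_norm_sq]
      simp only [hf]
      split_ifs
      exacts [hpp, hqq, hself k]
    · simp only [hf]
      split_ifs with hki hmi hmj hkj hmi hmj hmi hmj
      · exact absurd (hki.trans hmi.symm) hkm
      · exact hpq
      · exact hpk m hmi hmj
      · rw [real_inner_comm]; exact hpq
      · exact absurd (hkj.trans hmj.symm) hkm
      · exact hqk m hmi hmj
      · rw [real_inner_comm]; exact hpk k hki hkj
      · rw [real_inner_comm]; exact hqk k hki hkj
      · exact horth k m hkm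
  obtain ⟨b, hb⟩ := Orthonormal.exists_orthonormalBasis_extension_of_card_eq (𝕜 := ℝ)
    (v := f) (s := Set.univ) (by simp) (hon.comp _ Subtype.val_injective)
  refine ⟨b, ?_, ?_, ?_⟩
  · rw [hb i trivial]; simp [hf]
  · rw [hb j trivial]; simp [hf, hij.symm]
  · intro k hki hkj
    rw [hb k trivial]; simp [hf, hki, hkj]

theorem projectionAverage_eq_mul (K : Set 𝔼) (w : OrthonormalBasis (Fin n) ℝ 𝔼) {i j : Fin n}
    (hij : i ≠ j) :
    projectionAverage K w = projVol K (w i) * projVol K (w j) *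
      ∏ k ∈ (Finset.univ.erase i).erase j, projVol K (w k) := by
  rw [projectionAverage, ← Finset.mul_prod_erase _ _ (Finset.mem_univ i),
    ← Finset.mul_prod_erase _ _ (Finset.mem_erase.2 ⟨hij.symm, Finset.mem_univ j⟩), mul_assoc]

/-- Of two members of a best frame for a polytope, at least one is parallel to a facet. -/
theorem IsBestFrame.exists_facet_parallelTo {P : Set 𝔼} (hP : IsConvexBody P)
    (hPoly : IsPolytope P) {u : OrthonormalBasis (Fin n) ℝ 𝔼} (hu : IsBestFrame P u)
    {i j : Fin n} (hij : i ≠ j) (hi : ∀ F, IsFacet P F → ¬ ParallelTo (u i) F) :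
    ∃ F, IsFacet P F ∧ ParallelTo (u j) F := by
  by_contra! hj
  obtain ⟨a, ha⟩ := exists_linear_eventually_projVol_eq hP hPoly (u.norm_eq_one i) hi
  obtain ⟨b, hb⟩ := exists_linear_eventually_projVol_eq hP hPoly (u.norm_eq_one j) hj
  have ha0 := ha.self_of_nhds (u.norm_eq_one i)
  have hb0 := hb.self_of_nhds (u.norm_eq_one j)
  have hapos : 0 < a (u i) := by
    rw [← ENNReal.ofReal_pos, ← ha0]; exact projVol_pos hP.nonempty_interior _
  have hbpos : 0 < b (u j) := by
    rw [← ENNReal.ofReal_pos, ← hb0]; exact projVol_pos hP.nonempty_interior _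
  have hsqrt : ∀ t : ℝ, √(1 + t ^ 2) ≠ 0 := fun t ↦ by positivity
  set p : ℝ → 𝔼 := fun t ↦ (√(1 + t ^ 2))⁻¹ • (u i + t • u j) with hp
  set q : ℝ → 𝔼 := fun t ↦ (√(1 + t ^ 2))⁻¹ • (u j - t • u i) with hq
  have hptend : Tendsto p (𝓝 0) (𝓝 (u i)) := by
    have : Continuous p := by fun_prop (disch := exact hsqrt _)
    simpa [hp] using this.tendsto 0
  have hqtend : Tendsto q (𝓝 0) (𝓝 (u j)) := by
    have : Continuous q := by fun_prop (disch := exact hsqrt _)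
    simpa [hq] using this.tendsto 0
  refine false_of_forall_small_mul_le (a₂ := a (u j)) (b₁ := b (u i)) hapos hbpos ?_
  filter_upwards [hptend.eventually ha, hqtend.eventually hb,
    hptend.eventually (a.continuous.continuousAt.eventually_const_lt hapos)] with t hat hbt hapt
  obtain ⟨w, hwi, hwj, hwk⟩ := exists_orthonormalBasis_rotate u hij t
  have hle := hu w
  rw [projectionAverage_eq_mul P u hij, projectionAverage_eq_mul P w hij] at hle
  have hrest : ∏ k ∈ (Finset.univ.erase i).erase j, projVol P (w k) =
      ∏ k ∈ (Finset.univ.erase i).erase j, projVol P (u k) := by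
    refine Finset.prod_congr rfl fun k hk ↦ ?_
    simp only [Finset.mem_erase, Finset.mem_univ, and_true] at hk
    rw [hwk k hk.2 hk.1]
  rw [hrest, ENNReal.mul_le_mul_iff_left
    (Finset.prod_ne_zero_iff.2 fun k _ ↦ (projVol_pos hP.nonempty_interior _).ne')
    (ENNReal.prod_ne_top fun k _ ↦ (projVol_lt_top P hP.isCompact _).ne)] at hle
  have hwi' : w i = p t := hwi
  have hwj' : w j = q t := hwj
  rw [ha0, hb0, hwi', hwj', hat (hwi' ▸ w.norm_eq_one i), hbt (hwj' ▸ w.norm_eq_one j),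
    ← ENNReal.ofReal_mul hapos.le, ← ENNReal.ofReal_mul hapt.le,
    ENNReal.ofReal_le_ofReal_iff'] at hle
  have hreal : a (u i) * b (u j) ≤ a (p t) * b (q t) :=
    hle.resolve_right (mul_pos hapos hbpos).not_ge
  have hpq : a (p t) * b (q t) * (1 + t ^ 2) =
      (a (u i) + t * a (u j)) * (b (u j) - t * b (u i)) := by
    have h1 : (√(1 + t ^ 2))⁻¹ * (√(1 + t ^ 2))⁻¹ * (1 + t ^ 2) = 1 := by
      rw [← mul_inv, Real.mul_self_sqrt (by positivity)]
      exact inv_mul_cancel₀ (by positivity)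
    simp only [hp, hq, map_smul, map_add, map_sub, smul_eq_mul]
    linear_combination (a (u i) + t * a (u j)) * (b (u j) - t * b (u i)) * h1
  rw [← hpq]
  exact mul_le_mul_of_nonneg_right hreal (by positivity)

end LoomisWhitney

theorem mainTheorem1 (n : ℕ) (hn : 1 ≤ n) (P : Set (EuclideanSpace ℝ (Fin n)))
    (hP : LoomisWhitney.IsConvexBody P) (hPoly : LoomisWhitney.IsPolytope P)
    (u : OrthonormalBasis (Fin n) ℝ (EuclideanSpace ℝ (Fin n)))
    (hu : LoomisWhitney.IsBestFrame P u) :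
    n - 1 ≤ {i : Fin n | ∃ F : Set (EuclideanSpace ℝ (Fin n)),
      LoomisWhitney.IsFacet P F ∧ LoomisWhitney.ParallelTo (u i) F}.ncard := by
  set S := {i : Fin n | ∃ F : Set (EuclideanSpace ℝ (Fin n)),
    LoomisWhitney.IsFacet P F ∧ LoomisWhitney.ParallelTo (u i) F} with hS
  have h1 : Sᶜ.ncard ≤ 1 := by
    refine (Set.ncard_le_one_iff (Set.toFinite _)).2 fun {i j} hi hj ↦ ?_
    by_contra hij
    exact hj (hu.exists_facet_parallelTo hP hPoly hij fun F hF hpar ↦ hi ⟨F, hF, hpar⟩)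
  have h2 := Set.ncard_add_ncard_compl S
  rw [Nat.card_fin] at h2
  omega
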